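/- Let $q\in[0,1)$, put $[k]_q=1+q+\cdots+q^{k-1}$ for $k\ge 1$ and $[k]_q!=[1]_q[2]_q\cdots[k]_q$, $[0]_q!=1$ (with $0^0=1$). Let $T(z)=\sum_{k=0}^\infty T_kz^k$, $T_k\in\mathbb C^{n\times m}$, be a power series converging in a disk $|z|<r$, $r>0$. For a function $f$ analytic in this disk let $$R_qf(z)=\frac{f(z)-f(qz)}{(1-q)z}\quad(z\neq0),\qquad R_qf(0)=f'(0).$$ Then the following are equivalent: 1. (Realization) There are $N\in\mathbb N_0$ and matrices $(C,A,B)\in\mathbb C^{n\times N}\times\mathbb C^{N\times N}\times\mathbb C^{N\times m}$ such that, for all $z$ in a neighborhood of the origin, all the matrices $I_N-(1-q)zq^jA$, $j\ge0$, are invertible, the infinite product below converges, and $$T(z)=C\prod_{j=0}^\infty\bigl(I_N-(1-q)zq^jA\bigr)^{-1}B .$$ 2. (Hankel operator) The block Hankel operator $H=\bigl(T_{i+j}\,[i+j]_q!\bigr)_{i,j=0}^\infty$, acting from the finitely supported sequences in $\mathbb C^m$ to the sequences in $\mathbb C^n$, has finite rank. 3. (Taylor series) There are $N\in\mathbb N_0$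 and matrices $(C,A,B)\in\mathbb C^{n\times N}\times\mathbb C^{N\times N}\times\mathbb C^{N\times m}$ such that $$T_k=\frac{CA^kB}{[k]_q!},\qquad k=0,1,2,\ldots$$ 4. ($q$-Jackson derivative) The linear span of the columns of the functions $R_q^kT$, $k=0,1,2,\ldots$, as a space of $\mathbb C^n$-valued functions on the disk $|z|<r$, is finite dimensional. (For $N=0$ the product of an $n\times 0$ and a $0\times m$ matrix is the zero matrix.) -/

import Mathlib

open Filter Topology

/-- The `q`-number `[k]_q = 1 + q + ⋯ + q ^ (k - 1)`, for `k ≥ 1`. -/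
def qNumber (q : ℝ) (k : ℕ) : ℝ := ∑ i ∈ Finset.range k, q ^ i

/-- The `q`-factorial `[k]_q! = [1]_q [2]_q ⋯ [k]_q`, with `[0]_q! = 1`. -/
def qFactorial (q : ℝ) (k : ℕ) : ℝ := ∏ j ∈ Finset.range k, qNumber q (j + 1)

/-- The `j`-th factor `I - (1 - q) z q ^ j A` (before inversion). -/
def qFactor {N : ℕ} (q : ℝ) (A : Matrix (Fin N) (Fin N) ℂ) (z : ℂ) (j : ℕ) :
    Matrix (Fin N) (Fin N) ℂ :=
  1 - ((1 - (q : ℂ)) * z * (q : ℂ) ^ j) • A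

/-- `P` is the value of the infinite product `∏_{j ≥ 0} (I - (1 - q) z q ^ j A)⁻¹`: every factor
is invertible and the partial products converge to `P`. -/
def HasQProduct {N : ℕ} (q : ℝ) (A : Matrix (Fin N) (Fin N) ℂ) (z : ℂ)
    (P : Matrix (Fin N) (Fin N) ℂ) : Prop :=
  (∀ j, IsUnit (qFactor q A z j)) ∧
    Tendsto (fun J : ℕ => ((List.range J).map fun j => (qFactor q A z j)⁻¹).prod) atTop (𝓝 P)

/-- `T(z) = C (∏_{j ≥ 0} (I - (1 - q) z q ^ j A)⁻¹) B` for all `z` in a neighborhood of `0`. -/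
def HasQRealization {n m : ℕ} (q : ℝ) (T : ℂ → Matrix (Fin n) (Fin m) ℂ) : Prop :=
  ∃ (N : ℕ) (C : Matrix (Fin n) (Fin N) ℂ) (A : Matrix (Fin N) (Fin N) ℂ)
    (B : Matrix (Fin N) (Fin m) ℂ),
    ∀ᶠ z in 𝓝 (0 : ℂ), ∃ P, HasQProduct q A z P ∧ T z = C * P * B

/-- The infinite block Hankel matrix whose `(i, j)` block is `[i + j]_q! T_{i + j}`. -/
def qHankel {n m : ℕ} (q : ℝ) (t : ℕ → Matrix (Fin n) (Fin m) ℂ) :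
    Matrix (ℕ × Fin n) (ℕ × Fin m) ℂ :=
  fun a b => (qFactorial q (a.1 + b.1) : ℂ) * t (a.1 + b.1) a.2 b.2

/-- The block Hankel operator, `(H v)_a = ∑_b H_{a b} v_b`, acting on the finitely supported
sequences of vectors in `ℂ ^ m`, with values in the sequences of vectors in `ℂ ^ n`. -/
noncomputable def qHankelOperator {n m : ℕ} (q : ℝ) (t : ℕ → Matrix (Fin n) (Fin m) ℂ) :
    ((ℕ × Fin m) →₀ ℂ) →ₗ[ℂ] (ℕ × Fin n → ℂ) :=
  Finsupp.linearCombination ℂ fun b a => qHankel q t a b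

/-- The `q`-Jackson derivative `R_q f (z) = (f(z) - f(qz)) / ((1 - q) z)`, extended to `z = 0` by
continuity, that is by `f'(0)`. -/
noncomputable def qJackson {n m : ℕ} (q : ℝ) (f : ℂ → Matrix (Fin n) (Fin m) ℂ) :
    ℂ → Matrix (Fin n) (Fin m) ℂ :=
  fun z => if z = 0 then Matrix.of fun i j => deriv (fun w => f w i j) 0
    else ((1 - (q : ℂ)) * z)⁻¹ • (f z - f ((q : ℂ) * z))

/-- The linear span of the columns of the functions `R_q ^ k T`, `k = 0, 1, …`, as a space of
`ℂ ^ n`-valued functions on the disk `|z| < r`. The values of `R_q ^ k T` on this disk depend only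
on the values of `T` there. -/
def qJacksonSpan {n m : ℕ} (q r : ℝ) (T : ℂ → Matrix (Fin n) (Fin m) ℂ) :
    Submodule ℂ (Metric.ball (0 : ℂ) r → Fin n → ℂ) :=
  Submodule.span ℂ
    (Set.range fun (p : ℕ × Fin m) (z : Metric.ball (0 : ℂ) r) (i : Fin n) =>
      ((qJackson q)^[p.1] T) z i p.2)

/-! All conditions are compared through the numbers `[k]_q! t k`. The series `E(z) = ∑ z ^ k A ^ k /
[k]_q!` satisfies `(1 - (1 - q) z A) E(z) = E(q z)`. Iterating, with `E(q ^ J z) → E(0) = 1`,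
identifies `E(z)` with the infinite product (`hasQProduct_qExp`), so 1 ↔ 3 is uniqueness of Taylor
coefficients.

Under 3 the Hankel blocks factor as `(C A ^ i) (A ^ j B)`, so the rank is at most `N`. Conversely
the range of the Hankel operator is invariant under the backward shift; if it is finite dimensional,
the shift on it yields `A`, evaluation of the zeroth block yields `C`, and the zeroth block column
yields `B`.

For 4, the `j`-th Taylor coefficient of `R_q ^ k T` is the Hankel block `(j, k)` divided by
`[j]_q!`. Hence the columns of these functions satisfy the same linear relations as the Hankel
columns (`ker_qJacksonOperator`), and the two spans are isomorphic. -/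

theorem hasSum_of_forall_eq {ι M : Type*} [AddCommMonoid M] [TopologicalSpace M] {f g : ι → M}
    {a : M} (hg : HasSum g a) (h : ∀ k, f k = g k) : HasSum f a :=
  funext h ▸ hg

/-! ### Power series in one complex variable -/

section PowerSeries

variable {E : Type*} [NormedAddCommGroup E] [NormedSpace ℂ E]

/-- The formal power series `∑ z ^ k c_k`. -/
noncomputable def powerSeriesOfCoeff (c : ℕ → E) : FormalMultilinearSeries ℂ ℂ E :=
  fun k => ContinuousMultilinearMap.mkPiRing ℂ (Fin k) (c k)

theorem coeff_powerSeriesOfCoeff (c : ℕ → E) (k : ℕ) : (powerSeriesOfCoeff c).coeff k = c k := by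
  simp [FormalMultilinearSeries.coeff, powerSeriesOfCoeff]

theorem hasFPowerSeriesAt_of_eventually_hasSum {c : ℕ → E} {f : ℂ → E}
    (h : ∀ᶠ z in 𝓝 (0 : ℂ), HasSum (fun k : ℕ => z ^ k • c k) (f z)) :
    HasFPowerSeriesAt f (powerSeriesOfCoeff c) 0 := by
  rw [hasFPowerSeriesAt_iff]
  simpa [coeff_powerSeriesOfCoeff] using h

theorem coeff_unique_of_eventually_hasSum {c d : ℕ → E} {f : ℂ → E}
    (hc : ∀ᶠ z in 𝓝 (0 : ℂ), HasSum (fun k : ℕ => z ^ k • c k) (f z))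
    (hd : ∀ᶠ z in 𝓝 (0 : ℂ), HasSum (fun k : ℕ => z ^ k • d k) (f z)) : c = d := by
  have h := (hasFPowerSeriesAt_of_eventually_hasSum hc).eq_formalMultilinearSeries
    (hasFPowerSeriesAt_of_eventually_hasSum hd)
  funext k
  simpa [coeff_powerSeriesOfCoeff] using congrArg (fun p => p.coeff k) h

theorem deriv_zero_of_eventually_hasSum {c : ℕ → E} {f : ℂ → E}
    (h : ∀ᶠ z in 𝓝 (0 : ℂ), HasSum (fun k : ℕ => z ^ k • c k) (f z)) : deriv f 0 = c 1 := by
  exact (hasFPowerSeriesAt_of_eventually_hasSum h).deriv.trans (coeff_powerSeriesOfCoeff c 1)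

end PowerSeries

theorem matrix_hasSum_iff {ι : Type*} {n m : ℕ} {f : ι → Matrix (Fin n) (Fin m) ℂ}
    {S : Matrix (Fin n) (Fin m) ℂ} :
    HasSum f S ↔ ∀ i j, HasSum (fun k => f k i j) (S i j) := by
  rw [show HasSum f S ↔ ∀ i, HasSum (fun k => f k i) (S i) from Pi.hasSum]
  exact forall_congr' fun i => Pi.hasSum

/-- Passing to scalar entries avoids the choice of a matrix norm. -/
theorem matrix_coeff_unique {n m : ℕ} {c d : ℕ → Matrix (Fin n) (Fin m) ℂ}
    {f : ℂ → Matrix (Fin n) (Fin m) ℂ}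
    (hc : ∀ᶠ z in 𝓝 (0 : ℂ), HasSum (fun k : ℕ => z ^ k • c k) (f z))
    (hd : ∀ᶠ z in 𝓝 (0 : ℂ), HasSum (fun k : ℕ => z ^ k • d k) (f z)) : c = d := by
  funext k
  ext i j
  exact congrFun (coeff_unique_of_eventually_hasSum (c := fun k => c k i j)
    (d := fun k => d k i j) (f := fun z => f z i j)
    (hc.mono fun z hz => matrix_hasSum_iff.1 hz i j)
    (hd.mono fun z hz => matrix_hasSum_iff.1 hz i j)) k

/-! ### `q`-numbers and `q`-factorials -/

theorem one_le_qNumber_succ {q : ℝ} (hq : 0 ≤ q) (k : ℕ) : 1 ≤ qNumber q (k + 1) := by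
  rw [qNumber, Finset.sum_range_succ']
  have : 0 ≤ ∑ i ∈ Finset.range k, q ^ (i + 1) := Finset.sum_nonneg fun i _ => pow_nonneg hq _
  simpa using this

theorem qFactorial_zero (q : ℝ) : qFactorial q 0 = 1 := by simp [qFactorial]

theorem qFactorial_succ (q : ℝ) (k : ℕ) :
    qFactorial q (k + 1) = qFactorial q k * qNumber q (k + 1) :=
  Finset.prod_range_succ _ _

theorem one_le_qFactorial {q : ℝ} (hq : 0 ≤ q) (k : ℕ) : 1 ≤ qFactorial q k := by
  induction k with
  | zero => simp [qFactorial_zero]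
  | succ k ih =>
    rw [qFactorial_succ]
    exact one_le_mul_of_one_le_of_one_le ih (one_le_qNumber_succ hq k)

theorem qFactorial_ne_zero {q : ℝ} (hq : 0 ≤ q) (k : ℕ) : (qFactorial q k : ℂ) ≠ 0 := by
  have := one_le_qFactorial hq k
  exact_mod_cast (by linarith : qFactorial q k ≠ 0)

theorem one_sub_mul_qNumber (q : ℝ) (k : ℕ) :
    (1 - (q : ℂ)) * (qNumber q k : ℂ) = 1 - (q : ℂ) ^ k := by
  have := mul_neg_geom_sum q k
  rw [qNumber]
  exact_mod_cast this

/-! ### The `q`-exponential series in a Banach algebra -/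

section QExp

/-- The factor `‖1‖` keeps the case `k = 0` valid without `NormOneClass`, which fails for `0 × 0`
matrices. -/
theorem norm_pow_le_norm_one_mul {𝔸 : Type*} [NormedRing 𝔸] (a : 𝔸) (k : ℕ) :
    ‖a ^ k‖ ≤ ‖(1 : 𝔸)‖ * ‖a‖ ^ k := by
  induction k with
  | zero => simp
  | succ k ih =>
    rw [pow_succ, pow_succ, ← mul_assoc]
    exact (norm_mul_le _ _).trans (by gcongr)

variable {𝔸 : Type*} [NormedRing 𝔸] [NormedAlgebra ℂ 𝔸]

/-- The `k`-th coefficient `a ^ k / [k]_q!` of the `q`-exponential series. -/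
noncomputable def qExpCoeff (q : ℝ) (a : 𝔸) (k : ℕ) : 𝔸 := (qFactorial q k : ℂ)⁻¹ • a ^ k

/-- The `q`-exponential `∑ z ^ k a ^ k / [k]_q!`. -/
noncomputable def qExp (q : ℝ) (a : 𝔸) (z : ℂ) : 𝔸 := ∑' k : ℕ, z ^ k • qExpCoeff q a k

theorem hasSum_qExp [CompleteSpace 𝔸] {q : ℝ} (hq : 0 ≤ q) (a : 𝔸) {z : ℂ}
    (hz : ‖z‖ * ‖a‖ < 1) :
    HasSum (fun k : ℕ => z ^ k • qExpCoeff q a k) (qExp q a z) := by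
  apply Summable.hasSum
  refine Summable.of_norm_bounded (g := fun k => ‖(1 : 𝔸)‖ * (‖z‖ * ‖a‖) ^ k)
    ((summable_geometric_of_lt_one (by positivity) hz).mul_left _) fun k => ?_
  have h1 := one_le_qFactorial hq k
  have h2 : ‖(qFactorial q k : ℂ)⁻¹‖ ≤ 1 := by
    rw [norm_inv, Complex.norm_real, Real.norm_of_nonneg (by linarith)]
    exact inv_le_one_of_one_le₀ h1
  rw [qExpCoeff, norm_smul, norm_smul, norm_pow, mul_pow]
  calc ‖z‖ ^ k * (‖(qFactorial q k : ℂ)⁻¹‖ * ‖a ^ k‖)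
      ≤ ‖z‖ ^ k * (1 * (‖(1 : 𝔸)‖ * ‖a‖ ^ k)) := by
        gcongr
        exact norm_pow_le_norm_one_mul a k
    _ = ‖(1 : 𝔸)‖ * (‖z‖ ^ k * ‖a‖ ^ k) := by ring

theorem eventually_norm_mul_lt_one (x : ℝ) : ∀ᶠ z in 𝓝 (0 : ℂ), ‖z‖ * x < 1 := by
  have : Tendsto (fun z : ℂ => ‖z‖ * x) (𝓝 0) (𝓝 (‖(0 : ℂ)‖ * x)) :=
    (continuous_norm.mul continuous_const).tendsto 0
  exact this.eventually_lt_const (by simp)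

theorem continuousAt_qExp [CompleteSpace 𝔸] {q : ℝ} (hq : 0 ≤ q) (a : 𝔸) :
    ContinuousAt (qExp q a) 0 :=
  (hasFPowerSeriesAt_of_eventually_hasSum
    ((eventually_norm_mul_lt_one ‖a‖).mono fun _ hz => hasSum_qExp hq a hz)).continuousAt

theorem qExp_zero (q : ℝ) (a : 𝔸) : qExp q a 0 = 1 := by
  rw [qExp, tsum_eq_single 0 fun k hk => by simp [hk]]
  simp [qExpCoeff, qFactorial_zero]

/-- The functional equation `(1 - (1 - q) z a) E(z) = E(q z)`. -/
theorem one_sub_smul_mul_qExp [CompleteSpace 𝔸] {q : ℝ} (hq0 : 0 ≤ q) (hq1 : q < 1) (a : 𝔸)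
    {z : ℂ} (hz : ‖z‖ * ‖a‖ < 1) :
    (1 - ((1 - (q : ℂ)) * z) • a) * qExp q a z = qExp q a (q * z) := by
  have hqz : ‖(q : ℂ) * z‖ * ‖a‖ < 1 := by
    rw [norm_mul, Complex.norm_real, Real.norm_of_nonneg hq0]
    have : q * (‖z‖ * ‖a‖) ≤ 1 * (‖z‖ * ‖a‖) := by gcongr
    linarith
  have h := hasSum_qExp hq0 a hz
  have hdiff := h.sub (hasSum_qExp hq0 a hqz)
  have hmul := h.mul_left (((1 - (q : ℂ)) * z) • a)
  -- The constant terms of `E(z)` and `E(q z)` cancel. After the index shift, `1 - q ^ (k + 1) = (1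
  -- - q) [k + 1]_q` cancels the last factor of `[k + 1]_q!`.
  rw [← hasSum_nat_add_iff' 1] at hdiff
  simp only [Finset.sum_range_one, pow_zero, sub_self, sub_zero] at hdiff
  have key : HasSum (fun k : ℕ => ((1 - (q : ℂ)) * z) • a * z ^ k • qExpCoeff q a k)
      (qExp q a z - qExp q a (q * z)) := by
    refine hasSum_of_forall_eq hdiff fun k => ?_
    have h0 := qFactorial_ne_zero hq0 k
    have h1 := qFactorial_ne_zero hq0 (k + 1)
    have h2 := one_sub_mul_qNumber q (k + 1)
    have h3 : (qFactorial q (k + 1) : ℂ) = qFactorial q k * qNumber q (k + 1) := by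
      rw [qFactorial_succ]; push_cast; rfl
    have h4 : (qNumber q (k + 1) : ℂ) ≠ 0 := by
      intro h; rw [h, mul_zero] at h3; exact h1 h3
    rw [qExpCoeff, qExpCoeff, smul_mul_assoc, mul_smul_comm, mul_smul_comm, ← pow_succ',
      smul_smul, smul_smul, smul_smul, smul_smul, ← sub_smul, mul_pow]
    congr 1
    have : z ^ (k + 1) - (q : ℂ) ^ (k + 1) * z ^ (k + 1) =
        z ^ (k + 1) * ((1 - (q : ℂ)) * qNumber q (k + 1)) := by rw [h2]; ring
    rw [← sub_mul, this, h3]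
    field_simp
    ring
  rw [sub_mul, one_mul, hmul.unique key]
  abel

end QExp

/-! ### The infinite product -/

section Product

open scoped Matrix.Norms.Operator

variable {N : ℕ}

theorem hasQProduct_qExp {q : ℝ} (hq0 : 0 ≤ q) (hq1 : q < 1) (A : Matrix (Fin N) (Fin N) ℂ)
    {z : ℂ} (hz : ‖z‖ * ‖A‖ < 1) : HasQProduct q A z (qExp q A z) := by
  have hpow (j : ℕ) : ‖z * (q : ℂ) ^ j‖ * ‖A‖ < 1 := by
    have h1 : q ^ j ≤ 1 := pow_le_one₀ hq0 hq1.le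
    rw [norm_mul, norm_pow, Complex.norm_real, Real.norm_of_nonneg hq0]
    have : q ^ j * (‖z‖ * ‖A‖) ≤ 1 * (‖z‖ * ‖A‖) := by gcongr
    linarith
  have hunit (j : ℕ) : IsUnit (qFactor q A z j) := by
    apply isUnit_one_sub_of_norm_lt_one
    have h1 : ‖1 - (q : ℂ)‖ ≤ 1 := by
      rw [← Complex.ofReal_one, ← Complex.ofReal_sub, Complex.norm_real,
        Real.norm_of_nonneg (by linarith)]
      linarith
    calc _ ≤ ‖1 - (q : ℂ)‖ * (‖z * (q : ℂ) ^ j‖ * ‖A‖) := by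
          rw [norm_smul, mul_assoc, norm_mul, mul_assoc]
      _ ≤ 1 * (‖z * (q : ℂ) ^ j‖ * ‖A‖) := by gcongr
      _ < 1 := by simpa using hpow j
  refine ⟨hunit, ?_⟩
  have hstep (j : ℕ) : qFactor q A z j * qExp q A (z * (q : ℂ) ^ j) =
      qExp q A (z * (q : ℂ) ^ (j + 1)) := by
    have := one_sub_smul_mul_qExp hq0 hq1 A (hpow j)
    rw [qFactor, mul_assoc, this]
    congr 1
    ring
  have hprod (J : ℕ) : ((List.range J).map fun j => (qFactor q A z j)⁻¹).prod *
      qExp q A (z * (q : ℂ) ^ J) = qExp q A z := by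
    induction J with
    | zero => simp
    | succ J ih =>
      rw [List.range_succ, List.map_append, List.prod_append, List.map_singleton,
        List.prod_singleton, ← hstep J, mul_assoc, ← mul_assoc _⁻¹,
        Matrix.nonsing_inv_mul _ ((Matrix.isUnit_iff_isUnit_det _).1 (hunit J)), one_mul, ih]
  have hlim : Tendsto (fun J : ℕ => qExp q A (z * (q : ℂ) ^ J)) atTop (𝓝 1) := by
    have h0 : Tendsto (fun J : ℕ => z * (q : ℂ) ^ J) atTop (𝓝 0) := by
      have : ‖(q : ℂ)‖ < 1 := by rwa [Complex.norm_real, Real.norm_of_nonneg hq0]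
      simpa using (tendsto_pow_atTop_nhds_zero_of_norm_lt_one this).const_mul z
    have := (continuousAt_qExp hq0 A).tendsto.comp h0
    rwa [qExp_zero] at this
  have hunits : ∀ᶠ J : ℕ in atTop, IsUnit (qExp q A (z * (q : ℂ) ^ J)) :=
    hlim.eventually (Units.isOpen.mem_nhds isUnit_one)
  -- Since `E(q ^ J z) → 1`, its inverse also tends to `1`. For large `J` the partial product is
  -- `E(z)` times this inverse.
  have hinv := (NormedRing.inverse_continuousAt
    (1 : (Matrix (Fin N) (Fin N) ℂ)ˣ)).tendsto.comp hlim
  have h := hinv.const_mul (qExp q A z)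
  simp only [Units.val_one, Ring.inverse_one, mul_one] at h
  refine h.congr' (hunits.mono fun J hJ => ?_)
  simp only [Function.comp_apply]
  rw [← hprod J, Ring.mul_inverse_cancel_right _ _ hJ]

theorem eventually_hasQProduct_and_hasSum {q : ℝ} (hq0 : 0 ≤ q) (hq1 : q < 1)
    (A : Matrix (Fin N) (Fin N) ℂ) :
    ∀ᶠ z in 𝓝 (0 : ℂ), ∃ P, HasQProduct q A z P ∧
      HasSum (fun k : ℕ => z ^ k • ((qFactorial q k : ℂ)⁻¹ • A ^ k)) P :=
  (eventually_norm_mul_lt_one ‖A‖).mono fun z hz =>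
    ⟨qExp q A z, hasQProduct_qExp hq0 hq1 A hz, hasSum_qExp hq0 A hz⟩

end Product

theorem hasQRealization_iff_coeff {n m : ℕ} {q : ℝ} (hq0 : 0 ≤ q) (hq1 : q < 1)
    {t : ℕ → Matrix (Fin n) (Fin m) ℂ} {T : ℂ → Matrix (Fin n) (Fin m) ℂ}
    (hT : ∀ᶠ z in 𝓝 (0 : ℂ), HasSum (fun k : ℕ => z ^ k • t k) (T z)) :
    HasQRealization q T ↔ ∃ (N : ℕ) (C : Matrix (Fin n) (Fin N) ℂ)
      (A : Matrix (Fin N) (Fin N) ℂ) (B : Matrix (Fin N) (Fin m) ℂ),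
        ∀ k : ℕ, t k = (qFactorial q k : ℂ)⁻¹ • (C * A ^ k * B) := by
  have hsum {N : ℕ} (C : Matrix (Fin n) (Fin N) ℂ) (A : Matrix (Fin N) (Fin N) ℂ)
      (B : Matrix (Fin N) (Fin m) ℂ) {P : Matrix (Fin N) (Fin N) ℂ} {z : ℂ}
      (h : HasSum (fun k : ℕ => z ^ k • ((qFactorial q k : ℂ)⁻¹ • A ^ k)) P) :
      HasSum (fun k : ℕ => z ^ k • ((qFactorial q k : ℂ)⁻¹ • (C * A ^ k * B))) (C * P * B) := by
    have := h.map ((Matrix.addMonoidHomMulRight B).comp (Matrix.addMonoidHomMulLeft C))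
      (f := fun k : ℕ => z ^ k • ((qFactorial q k : ℂ)⁻¹ • A ^ k))
      ((continuous_const.matrix_mul continuous_id).matrix_mul continuous_const)
    refine hasSum_of_forall_eq this fun k => ?_
    simp [Matrix.addMonoidHomMulRight, Matrix.addMonoidHomMulLeft]
  constructor
  · rintro ⟨N, C, A, B, h⟩
    refine ⟨N, C, A, B, congrFun (matrix_coeff_unique hT ?_)⟩
    filter_upwards [h, eventually_hasQProduct_and_hasSum hq0 hq1 A]
      with z ⟨P, hP, hTz⟩ ⟨P', hP', hs⟩
    -- Uniqueness of limits turns the given value of the product into the sum of the `q`-exponential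
    -- series.
    rw [hTz, tendsto_nhds_unique hP.2 hP'.2]
    exact hsum C A B hs
  · rintro ⟨N, C, A, B, h⟩
    refine ⟨N, C, A, B, ?_⟩
    filter_upwards [hT, eventually_hasQProduct_and_hasSum hq0 hq1 A] with z hz ⟨P, hP, hs⟩
    refine ⟨P, hP, hz.unique ?_⟩
    simpa only [h] using hsum C A B hs

/-! ### The Hankel operator -/

theorem qHankelOperator_single {n m : ℕ} (q : ℝ) (t : ℕ → Matrix (Fin n) (Fin m) ℂ)
    (b : ℕ × Fin m) :
    qHankelOperator q t (Finsupp.single b 1) = fun a => qHankel q t a b := by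
  simp [qHankelOperator]

theorem finiteDimensional_range_qHankelOperator {n m N : ℕ} {q : ℝ} (hq : 0 ≤ q)
    {t : ℕ → Matrix (Fin n) (Fin m) ℂ} (C : Matrix (Fin n) (Fin N) ℂ)
    (A : Matrix (Fin N) (Fin N) ℂ) (B : Matrix (Fin N) (Fin m) ℂ)
    (h : ∀ k : ℕ, t k = (qFactorial q k : ℂ)⁻¹ • (C * A ^ k * B)) :
    FiniteDimensional ℂ (LinearMap.range (qHankelOperator q t)) := by
  -- `L` sends a state `x` to `(C A ^ a x)_a`; column `b` of `A ^ k B` maps to the Hankel column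
  -- `(k, b)`.
  let L : (Fin N → ℂ) →ₗ[ℂ] (ℕ × Fin n → ℂ) :=
    LinearMap.pi fun a => LinearMap.proj a.2 ∘ₗ Matrix.mulVecLin (C * A ^ a.1)
  refine Submodule.finiteDimensional_of_le (S₂ := LinearMap.range L) ?_
  rw [qHankelOperator, Finsupp.range_linearCombination, Submodule.span_le]
  rintro _ ⟨⟨k, b⟩, rfl⟩
  refine ⟨(A ^ k * B).col b, ?_⟩
  funext ⟨a, i⟩
  have : (C * A ^ a * (A ^ k * B)) i b = (C * A ^ (a + k) * B) i b := by
    simp only [pow_add, Matrix.mul_assoc]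
  simp only [qHankel, h, Matrix.smul_apply, smul_eq_mul, mul_inv_cancel_left₀
    (qFactorial_ne_zero hq _), ← this]
  rfl

/-- The backward shift on sequences of vectors in `ℂ ^ n`. -/
def backwardShift (n : ℕ) : (ℕ × Fin n → ℂ) →ₗ[ℂ] (ℕ × Fin n → ℂ) :=
  LinearMap.funLeft ℂ ℂ fun a => (a.1 + 1, a.2)

/-- Blocks depend only on `i + j`, so dropping the top block row amounts to moving one block column
to the right. -/
theorem backwardShift_qHankel {n m : ℕ} (q : ℝ) (t : ℕ → Matrix (Fin n) (Fin m) ℂ)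
    (k : ℕ) (b : Fin m) :
    backwardShift n (fun a => qHankel q t a (k, b)) = fun a => qHankel q t a (k + 1, b) := by
  funext a
  simp only [backwardShift, LinearMap.funLeft_apply, qHankel]
  rw [add_right_comm, add_assoc]

/-- The shift realization: the state space is the range `V` itself, and `S ^ k` carries block column
`0` to block column `k`, whose top block is `[k]_q! t k`. -/
theorem exists_coeff_of_finiteDimensional_range {n m : ℕ} {q : ℝ} (hq : 0 ≤ q)
    {t : ℕ → Matrix (Fin n) (Fin m) ℂ}
    (h : FiniteDimensional ℂ (LinearMap.range (qHankelOperator q t))) :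
    ∃ (N : ℕ) (C : Matrix (Fin n) (Fin N) ℂ) (A : Matrix (Fin N) (Fin N) ℂ)
      (B : Matrix (Fin N) (Fin m) ℂ),
        ∀ k : ℕ, t k = (qFactorial q k : ℂ)⁻¹ • (C * A ^ k * B) := by
  set V := LinearMap.range (qHankelOperator q t) with hV
  have hcol (b : ℕ × Fin m) : (fun a => qHankel q t a b) ∈ V :=
    ⟨_, qHankelOperator_single q t b⟩
  have hinv : ∀ x ∈ V, backwardShift n x ∈ V := by
    have : V ≤ V.comap (backwardShift n) := by
      conv_lhs => rw [hV, qHankelOperator, Finsupp.range_linearCombination]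
      rw [Submodule.span_le]
      rintro _ ⟨⟨k, b⟩, rfl⟩
      change backwardShift n _ ∈ V
      rw [backwardShift_qHankel]
      exact hcol _
    exact this
  let S : V →ₗ[ℂ] V := (backwardShift n).restrict hinv
  let v (k : ℕ) (b : Fin m) : V := ⟨_, hcol (k, b)⟩
  have hS (k : ℕ) (b : Fin m) : (S ^ k) (v 0 b) = v k b := by
    induction k with
    | zero => rfl
    | succ k ih =>
      rw [pow_succ', Module.End.mul_apply, ih]
      exact Subtype.ext (backwardShift_qHankel q t k b)
  let e := Module.finBasis ℂ V
  let ev : V →ₗ[ℂ] (Fin n → ℂ) := LinearMap.pi fun i => LinearMap.proj (0, i) ∘ₗ V.subtype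
  let A := LinearMap.toMatrix e e S
  let C := LinearMap.toMatrix e (Pi.basisFun ℂ (Fin n)) ev
  let B : Matrix (Fin (Module.finrank ℂ V)) (Fin m) ℂ := Matrix.of fun j b => e.repr (v 0 b) j
  refine ⟨_, C, A, B, fun k => ?_⟩
  have hA : A ^ k = LinearMap.toMatrix e e (S ^ k) := LinearMap.toMatrix_pow e S k
  ext i b
  have key : (C * A ^ k * B) i b = qHankel q t (0, i) (k, b) := by
    rw [hA, ← LinearMap.toMatrix_comp]
    have := congrFun (LinearMap.toMatrix_mulVec_repr e (Pi.basisFun ℂ (Fin n))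
      (ev ∘ₗ (S ^ k)) (v 0 b)) i
    rw [Pi.basisFun_repr, LinearMap.comp_apply, hS] at this
    exact this
  rw [Matrix.smul_apply, key, qHankel, smul_eq_mul, zero_add,
    inv_mul_cancel_left₀ (qFactorial_ne_zero hq k)]

/-! ### The `q`-Jackson derivative -/

/-- Termwise, `R_q z ^ (k + 1) = [k + 1]_q z ^ k`. The disk is stable under `z ↦ q z`, so both
series converge there. -/
theorem hasSum_qJackson {n m : ℕ} {q r : ℝ} (hq0 : 0 ≤ q) (hq1 : q < 1) (hr : 0 < r)
    {s : ℕ → Matrix (Fin n) (Fin m) ℂ} {f : ℂ → Matrix (Fin n) (Fin m) ℂ}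
    (hf : ∀ z ∈ Metric.ball (0 : ℂ) r, HasSum (fun k : ℕ => z ^ k • s k) (f z))
    {z : ℂ} (hz : z ∈ Metric.ball (0 : ℂ) r) :
    HasSum (fun k : ℕ => z ^ k • ((qNumber q (k + 1) : ℂ) • s (k + 1))) (qJackson q f z) := by
  by_cases h0 : z = 0
  · subst h0
    have hval : qJackson q f 0 = s 1 := by
      ext i j
      simp only [qJackson, if_true, Matrix.of_apply]
      refine deriv_zero_of_eventually_hasSum (c := fun k => s k i j) ?_
      filter_upwards [Metric.ball_mem_nhds 0 hr] with w hw
      exact matrix_hasSum_iff.1 (hf w hw) i j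
    rw [hval]
    -- At `z = 0` only the term `k = 0` survives, and `[1]_q = 1`.
    convert hasSum_single (f := fun k : ℕ =>
      (0 : ℂ) ^ k • ((qNumber q (k + 1) : ℂ) • s (k + 1))) 0 fun k hk => by simp [hk] using 1
    simp [qNumber]
  · have hqz : (q : ℂ) * z ∈ Metric.ball (0 : ℂ) r := by
      rw [mem_ball_zero_iff] at hz ⊢
      rw [norm_mul, Complex.norm_real, Real.norm_of_nonneg hq0]
      have : q * ‖z‖ ≤ 1 * ‖z‖ := by gcongr
      linarith
    have hdiff := (hf z hz).sub (hf _ hqz)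
    rw [← hasSum_nat_add_iff' 1] at hdiff
    simp only [Finset.sum_range_one, pow_zero, sub_self, sub_zero] at hdiff
    have h := hdiff.const_smul ((1 - (q : ℂ)) * z)⁻¹
    have h1 : 1 - (q : ℂ) ≠ 0 := by
      rw [sub_ne_zero]; exact_mod_cast hq1.ne'
    rw [qJackson, if_neg h0]
    refine hasSum_of_forall_eq h fun k => ?_
    rw [← sub_smul, smul_smul, smul_smul]
    congr 1
    have : z ^ (k + 1) - ((q : ℂ) * z) ^ (k + 1) =
        z ^ (k + 1) * ((1 - (q : ℂ)) * qNumber q (k + 1)) := by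
      rw [one_sub_mul_qNumber]; ring
    rw [this]
    field_simp
    ring

theorem hasSum_iterate_qJackson {n m : ℕ} {q r : ℝ} (hq0 : 0 ≤ q) (hq1 : q < 1) (hr : 0 < r)
    {t : ℕ → Matrix (Fin n) (Fin m) ℂ} {T : ℂ → Matrix (Fin n) (Fin m) ℂ}
    (hT : ∀ z ∈ Metric.ball (0 : ℂ) r, HasSum (fun k : ℕ => z ^ k • t k) (T z)) (k : ℕ) :
    ∀ z ∈ Metric.ball (0 : ℂ) r, HasSum (fun j : ℕ => z ^ j •
      (((qFactorial q j : ℂ)⁻¹ * qFactorial q (j + k)) • t (j + k))) ((qJackson q)^[k] T z) := by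
  induction k with
  | zero =>
    intro z hz
    simpa [inv_mul_cancel₀ (qFactorial_ne_zero hq0 _)] using hT z hz
  | succ k ih =>
    intro z hz
    rw [Function.iterate_succ_apply']
    convert hasSum_qJackson hq0 hq1 hr ih hz using 1
    funext j
    have h0 := qFactorial_ne_zero hq0 j
    have h1 := qFactorial_ne_zero hq0 (j + 1)
    have h3 : (qFactorial q (j + 1) : ℂ) = qFactorial q j * qNumber q (j + 1) := by
      rw [qFactorial_succ]; push_cast; rfl
    have h4 : (qNumber q (j + 1) : ℂ) ≠ 0 := by
      intro h; rw [h, mul_zero] at h3; exact h1 h3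
    rw [smul_smul (qNumber q (j + 1) : ℂ), add_right_comm j 1 k, add_assoc j k 1, h3]
    congr 2
    field_simp

/-- The linear map whose range is spanned by the columns of the iterated Jackson derivatives. -/
noncomputable def qJacksonOperator {n m : ℕ} (q r : ℝ) (T : ℂ → Matrix (Fin n) (Fin m) ℂ) :
    ((ℕ × Fin m) →₀ ℂ) →ₗ[ℂ] (Metric.ball (0 : ℂ) r → Fin n → ℂ) :=
  Finsupp.linearCombination ℂ fun p z i => ((qJackson q)^[p.1] T) z i p.2

/-- By linearity, any combination of Jackson columns has as Taylor coefficients the same combination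
of Hankel columns, row `j` being scaled by `1 / [j]_q!`. -/
theorem hasSum_qJacksonOperator {n m : ℕ} {q r : ℝ} (hq0 : 0 ≤ q) (hq1 : q < 1) (hr : 0 < r)
    {t : ℕ → Matrix (Fin n) (Fin m) ℂ} {T : ℂ → Matrix (Fin n) (Fin m) ℂ}
    (hT : ∀ z ∈ Metric.ball (0 : ℂ) r, HasSum (fun k : ℕ => z ^ k • t k) (T z))
    (c : (ℕ × Fin m) →₀ ℂ) (z : Metric.ball (0 : ℂ) r) (i : Fin n) :
    HasSum (fun j : ℕ => (z : ℂ) ^ j • ((qFactorial q j : ℂ)⁻¹ * qHankelOperator q t c (j, i)))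
      (qJacksonOperator q r T c z i) := by
  induction c using Finsupp.induction_linear with
  | zero => simp
  | add c d hc hd =>
    convert hc.add hd using 1
    · funext j
      simp only [map_add, Pi.add_apply, smul_eq_mul]
      ring
    · simp
  | single p x =>
    have h := (matrix_hasSum_iff.1
      (hasSum_iterate_qJackson hq0 hq1 hr hT p.1 z z.2) i p.2).const_smul x
    convert h using 1
    · funext j
      simp only [qHankelOperator, Finsupp.linearCombination_single, qHankel, Pi.smul_apply,
        Matrix.smul_apply, smul_eq_mul]
      ring
    · simp [qJacksonOperator]

/-- A function given by a power series on the disk vanishes exactly when its coefficients do, and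
the scaling by `1 / [j]_q!` is invertible. -/
theorem ker_qJacksonOperator {n m : ℕ} {q r : ℝ} (hq0 : 0 ≤ q) (hq1 : q < 1) (hr : 0 < r)
    {t : ℕ → Matrix (Fin n) (Fin m) ℂ} {T : ℂ → Matrix (Fin n) (Fin m) ℂ}
    (hT : ∀ z ∈ Metric.ball (0 : ℂ) r, HasSum (fun k : ℕ => z ^ k • t k) (T z)) :
    LinearMap.ker (qJacksonOperator q r T) = LinearMap.ker (qHankelOperator q t) := by
  ext c
  have hs := hasSum_qJacksonOperator hq0 hq1 hr hT c
  rw [LinearMap.mem_ker, LinearMap.mem_ker]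
  constructor
  · intro h
    funext ⟨j, i⟩
    have hzero : (fun j : ℕ => (qFactorial q j : ℂ)⁻¹ * qHankelOperator q t c (j, i)) =
        fun _ => 0 := by
      refine coeff_unique_of_eventually_hasSum (f := fun _ => (0 : ℂ)) ?_ (by simp)
      filter_upwards [Metric.ball_mem_nhds 0 hr] with z hz
      simpa [h] using hs ⟨z, hz⟩ i
    simpa [qFactorial_ne_zero hq0 j] using congrFun hzero j
  · intro h
    funext z i
    have := hs z i
    simp only [h, Pi.zero_apply, mul_zero, smul_zero] at this
    exact this.unique hasSum_zero

theorem finiteDimensional_qJacksonSpan_iff {n m : ℕ} {q r : ℝ} (hq0 : 0 ≤ q) (hq1 : q < 1)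
    (hr : 0 < r) {t : ℕ → Matrix (Fin n) (Fin m) ℂ} {T : ℂ → Matrix (Fin n) (Fin m) ℂ}
    (hT : ∀ z ∈ Metric.ball (0 : ℂ) r, HasSum (fun k : ℕ => z ^ k • t k) (T z)) :
    FiniteDimensional ℂ (qJacksonSpan q r T) ↔
      FiniteDimensional ℂ (LinearMap.range (qHankelOperator q t)) := by
  have hspan : qJacksonSpan q r T = LinearMap.range (qJacksonOperator q r T) :=
    (Finsupp.range_linearCombination ℂ).symm
  rw [hspan]
  -- Both ranges are quotients of the same space by the same kernel.
  let e := (qJacksonOperator q r T).quotKerEquivRange.symm ≪≫ₗ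
    Submodule.quotEquivOfEq _ _ (ker_qJacksonOperator hq0 hq1 hr hT) ≪≫ₗ
    (qHankelOperator q t).quotKerEquivRange
  exact ⟨fun _ => e.finiteDimensional, fun _ => e.symm.finiteDimensional⟩

theorem theorem5p7 {n m : ℕ} (q : ℝ) (hq0 : 0 ≤ q) (hq1 : q < 1)
    (r : ℝ) (hr : 0 < r)
    (t : ℕ → Matrix (Fin n) (Fin m) ℂ) (T : ℂ → Matrix (Fin n) (Fin m) ℂ)
    (hT : ∀ z ∈ Metric.ball (0 : ℂ) r, HasSum (fun k : ℕ => z ^ k • t k) (T z)) :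
    List.TFAE [
      HasQRealization q T,
      FiniteDimensional ℂ (LinearMap.range (qHankelOperator q t)),
      ∃ (N : ℕ) (C : Matrix (Fin n) (Fin N) ℂ) (A : Matrix (Fin N) (Fin N) ℂ)
        (B : Matrix (Fin N) (Fin m) ℂ),
        ∀ k : ℕ, t k = (qFactorial q k : ℂ)⁻¹ • (C * A ^ k * B),
      FiniteDimensional ℂ (qJacksonSpan q r T)] := by
  have hnear : ∀ᶠ z in 𝓝 (0 : ℂ), HasSum (fun k : ℕ => z ^ k • t k) (T z) := by
    filter_upwards [Metric.ball_mem_nhds 0 hr] with z hz using hT z hz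
  tfae_have 1 ↔ 3 := hasQRealization_iff_coeff hq0 hq1 hnear
  tfae_have 2 → 3 := exists_coeff_of_finiteDimensional_range hq0
  tfae_have 3 → 2 := fun ⟨_, C, A, B, h⟩ => finiteDimensional_range_qHankelOperator hq0 C A B h
  tfae_have 4 ↔ 2 := finiteDimensional_qJacksonSpan_iff hq0 hq1 hr hT
  tfae_finish
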